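/- Notation: $2^\omega$ is the Cantor space. For a countable ordinal $\eta\ge 1$, $\mathbf{\Sigma}^0_\eta$ and $\mathbf{\Pi}^0_\eta$ denote the additive and multiplicative Borel classes ($\mathbf{\Sigma}^0_1$ = open, $\mathbf{\Pi}^0_\eta$ = complements of $\mathbf{\Sigma}^0_\eta$ sets, and, for $\eta>1$, $\mathbf{\Sigma}^0_\eta$ = countable unions of sets from $\bigcup_{1\le\zeta<\eta}\mathbf{\Pi}^0_\zeta$). If $X,Y$ are Polish spaces, a Borel set $C\subseteq X\times Y$ is potentially $\mathbf{\Pi}^0_\eta$, written $C\in\mathrm{pot}(\mathbf{\Pi}^0_\eta)$, if there are finer Polish topologies $\sigma$ on $X$ and $\tau$ on $Y$ such that $C$ is a $\mathbf{\Pi}^0_\eta$ subset of $[X,\sigma]\times[Y,\tau]$. Theorem 1.13 (Debs). Let $\xi<\omega_1$. There is no Borel set $S\subseteq 2^\omega\times 2^\omega$ such that, for any Polish spaces $X,Y$ and any disjoint analytic subsets $A,B$ of $X\times Y$, exactly one of the following holds: (a) $A$ is separable from $B$ by a $\mathrm{pot}(\mathbf{\Pi}^0_{1+\xi})$ set, i.e.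 there is $C\in\mathrm{pot}(\mathbf{\Pi}^0_{1+\xi})$ with $A\subseteq C$ and $C\cap B=\emptyset$; (b) there are continuous maps $u:2^\omega\to X$ and $v:2^\omega\to Y$ with $S\subseteq (u\times v)^{-1}(A)$ and $(2^\omega\times 2^\omega)\setminus S\subseteq (u\times v)^{-1}(B)$. (So, in the known dichotomy in which the second inclusion of (b) is only required for $\overline{S}\setminus S$, one cannot replace $\overline{S}\setminus S$ by the full complement of $S$.) -/

import Mathlib

/-- The additive Baire classes of a topological space: `SigmaZero ξ A` says that `A` is `Σ⁰_ξ`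
(boldface). A set is `Σ⁰_1` iff it is open, and, for `ξ > 1`, it is `Σ⁰_ξ` iff it is a
union `⋃ n, A n` where each `A n` is `Π⁰_{η n}` (i.e. its complement is `Σ⁰_{η n}`) for some
`1 ≤ η n < ξ`. No set is `Σ⁰_0`. -/
inductive SigmaZero {X : Type*} [TopologicalSpace X] : Ordinal.{0} → Set X → Prop
  | isOpen {U : Set X} (hU : IsOpen U) : SigmaZero 1 U
  | iUnion {ξ : Ordinal.{0}} (hξ : 1 < ξ) (A : ℕ → Set X) (η : ℕ → Ordinal.{0})
      (hone : ∀ n, 1 ≤ η n) (hlt : ∀ n, η n < ξ) (hA : ∀ n, SigmaZero (η n) (A n)ᶜ) :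
      SigmaZero ξ (⋃ n, A n)

/-- The multiplicative Baire classes: `A` is `Π⁰_ξ` iff its complement is `Σ⁰_ξ`. -/
def PiZero {X : Type*} [TopologicalSpace X] (ξ : Ordinal.{0}) (A : Set X) : Prop :=
  SigmaZero ξ Aᶜ

/-- `A` is potentially `Π⁰_ξ`: it is a Borel subset of `X × Y`, and there are finer Polish
topologies `σ` on `X` and `τ` on `Y` such that `A` is `Π⁰_ξ` in `[X, σ] × [Y, τ]`.
(In Mathlib's order on topologies, `σ ≤ tX` means that `σ` is finer than `tX`.) -/
def PotPiZero {X Y : Type*} [tX : TopologicalSpace X] [tY : TopologicalSpace Y]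
    (ξ : Ordinal.{0}) (A : Set (X × Y)) : Prop :=
  @MeasurableSet (X × Y) (borel (X × Y)) A ∧
    ∃ (σ : TopologicalSpace X) (τ : TopologicalSpace Y),
      σ ≤ tX ∧ τ ≤ tY ∧ @PolishSpace X σ ∧ @PolishSpace Y τ ∧
        @PiZero (X × Y) (@instTopologicalSpaceProd X Y σ τ) ξ A

/-- `A` is separable from `B` by a potentially `Π⁰_ξ` set. -/
def SeparableByPotPiZero {X Y : Type*} [TopologicalSpace X] [TopologicalSpace Y]
    (ξ : Ordinal.{0}) (A B : Set (X × Y)) : Prop :=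
  ∃ C : Set (X × Y), PotPiZero ξ C ∧ A ⊆ C ∧ Disjoint C B

/-- There are continuous maps `u : 2^ω → X` and `v : 2^ω → Y` such that
`S ⊆ (u × v)⁻¹(A)` and `¬S ⊆ (u × v)⁻¹(B)`, where `¬S` is the complement of `S` in the whole
product `2^ω × 2^ω`. -/
def ReducesOnProduct {X Y : Type*} [TopologicalSpace X] [TopologicalSpace Y]
    (S : Set ((ℕ → Bool) × (ℕ → Bool))) (A B : Set (X × Y)) : Prop :=
  ∃ (u : (ℕ → Bool) → X) (v : (ℕ → Bool) → Y), Continuous u ∧ Continuous v ∧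
    S ⊆ Prod.map u v ⁻¹' A ∧ Sᶜ ⊆ Prod.map u v ⁻¹' B

/-!
A reduction of `(S, Sᶜ)` to a disjoint pair `(A, B)` has domain the whole of `2^ω × 2^ω`, so the
rectangle `range u ×ˢ range v` is contained in `A ∪ B`. It therefore suffices to find `A` and `B`
that are not separable although `A ∪ B` contains no rectangle with two points on each side: then
`u` or `v` is constant, so `S` is a Borel strip, hence potentially clopen, and `(S, Sᶜ)` satisfies
both alternatives.

For `A ∪ B` take the pairs whose difference lies in a Sidon set `K` of a Polish group; that
equation `a + d = b + c` has only trivial solutions in `K` is what excludes the rectangles. The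
set `K` consists of the indicators, in `List (ℕ × κ) → ℤ`, of the branches of the tree
`List (ℕ × κ)`, and `A`, `B` are cut out by requiring the `κ`-coordinates of the branch to form a
sequence in `D`, respectively `Dᶜ`, where `D` is a Borel set that is not `Π⁰_{1+ξ}`. Finer Polish
topologies change nothing on a comeager set, and the freedom in the `ℕ`-coordinates lets one
translate of `K` meet any given comeager set in branches that realise every sequence of
`κ`-coordinates continuously; a separating set would thus make `D` a `Π⁰_{1+ξ}` set.
-/

open Set Filter Topology MeasureTheory TopologicalSpace

instance polishSpace_cantor : PolishSpace (ℕ → Bool) where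
  toIsCompletelyMetrizableSpace := .pi_countable

/-! ### Borel classes -/

section BorelClasses

variable {X Y : Type*} [TopologicalSpace X] [TopologicalSpace Y] {ξ : Ordinal.{0}}

theorem SigmaZero.preimage {f : X → Y} (hf : Continuous f) {A : Set Y} (hA : SigmaZero ξ A) :
    SigmaZero ξ (f ⁻¹' A) := by
  induction hA with
  | isOpen hU => exact .isOpen (hU.preimage hf)
  | iUnion hξ A η hone hlt _ ih =>
    rw [preimage_iUnion]
    exact .iUnion hξ _ η hone hlt ih

theorem PiZero.preimage {f : X → Y} (hf : Continuous f) {A : Set Y} (hA : PiZero ξ A) :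
    PiZero ξ (f ⁻¹' A) :=
  SigmaZero.preimage hf hA

theorem PiZero.of_isClopen {A : Set X} (hA : IsClopen A) (hξ : 1 ≤ ξ) : PiZero ξ A := by
  rcases hξ.eq_or_lt with rfl | hξ
  · exact .isOpen hA.compl.isOpen
  · have hunion : SigmaZero ξ (⋃ _ : ℕ, Aᶜ) :=
      .iUnion hξ _ (fun _ ↦ 1) (fun _ ↦ le_rfl) (fun _ ↦ hξ)
        (fun _ ↦ .isOpen (by rw [compl_compl]; exact hA.isOpen))
    rwa [iUnion_const] at hunion

theorem potPiZero_prod [PolishSpace X] [MeasurableSpace X] [BorelSpace X] [PolishSpace Y]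
    [MeasurableSpace Y] [BorelSpace Y] (hξ : 1 ≤ ξ) {E : Set X} {F : Set Y}
    (hE : MeasurableSet E) (hF : MeasurableSet F) : PotPiZero ξ (E ×ˢ F) := by
  have hEF : MeasurableSet[borel (X × Y)] (E ×ˢ F) :=
    (BorelSpace.measurable_eq (α := X × Y)).le _ (hE.prod hF)
  obtain ⟨σ, hσ, hσp, hEσ⟩ := hE.isClopenable
  obtain ⟨τ, hτ, hτp, hFτ⟩ := hF.isClopenable
  refine ⟨hEF, σ, τ, hσ, hτ, hσp, hτp, ?_⟩
  exact @PiZero.of_isClopen (X × Y) (@instTopologicalSpaceProd X Y σ τ) ξ _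
    (@IsClopen.prod X Y σ τ E F hEσ hFτ) hξ

end BorelClasses

/-! ### Universal sets -/

section Parametrization

variable {X : Type*} [MeasurableSpace X]

/-- A family `𝒜` of subsets of `X` is Borel parametrized if a single Borel subset of `2^ω × X` has
every member of `𝒜` among its sections. Unlike for a universal set, the sections need not all
belong to `𝒜`. -/
def IsBorelParametrized (𝒜 : Set (Set X)) : Prop :=
  ∃ U : Set ((ℕ → Bool) × X), MeasurableSet U ∧ ∀ A ∈ 𝒜, ∃ p, Prod.mk p ⁻¹' U = A

theorem IsBorelParametrized.of_standardBorel {P : Type*} [MeasurableSpace P]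
    [StandardBorelSpace P] {𝒜 : Set (Set X)} {U : Set (P × X)} (hU : MeasurableSet U)
    (h𝒜 : ∀ A ∈ 𝒜, ∃ p, Prod.mk p ⁻¹' U = A) : IsBorelParametrized 𝒜 := by
  have he : MeasurableEmbedding (MeasurableSpace.mapNatBool P) :=
    (MeasurableSpace.measurable_mapNatBool P).measurableEmbedding
      (MeasurableSpace.injective_mapNatBool P)
  refine ⟨Prod.map (MeasurableSpace.mapNatBool P) id '' U,
    (he.prodMap .id).measurableSet_image.2 hU, fun A hA ↦ ?_⟩
  obtain ⟨p, rfl⟩ := h𝒜 A hA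
  refine ⟨MeasurableSpace.mapNatBool P p, ?_⟩
  ext x
  exact (he.prodMap .id).injective.mem_set_image (a := (p, x))

theorem isBorelParametrized_isOpen [TopologicalSpace X] [SecondCountableTopology X]
    [OpensMeasurableSpace X] : IsBorelParametrized {A : Set X | IsOpen A} := by
  classical
  let U : Set ((countableBasis X → Bool) × X) := ⋃ b, {q | q.1 b = true ∧ q.2 ∈ b.1}
  have hU : MeasurableSet U := .iUnion fun b ↦ .inter
    ((measurableSet_singleton true).preimage ((measurable_pi_apply b).comp measurable_fst))
    ((isOpen_of_mem_countableBasis b.2).measurableSet.preimage measurable_snd)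
  refine .of_standardBorel hU fun A hA ↦ ⟨fun b ↦ decide (b.1 ⊆ A), ?_⟩
  refine .trans ?_ ((isBasis_countableBasis X).open_eq_sUnion' hA).symm
  ext x
  simp [U, and_assoc, and_left_comm]

theorem IsBorelParametrized.iUnion_compl {ι : Type*} [Countable ι] {𝒜 : ι → Set (Set X)}
    (h𝒜 : ∀ i, IsBorelParametrized (𝒜 i)) :
    IsBorelParametrized {A | ∃ B : ℕ → Set X, (∀ n, ∃ i, (B n)ᶜ ∈ 𝒜 i) ∧ ⋃ n, B n = A} := by
  let _ : MeasurableSpace ι := ⊤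
  choose U hU hsection using h𝒜
  let V : Set ((ℕ → ι × (ℕ → Bool)) × X) :=
    ⋃ (n) (i), {q | (q.1 n).1 = i ∧ ((q.1 n).2, q.2) ∉ U i}
  have hV : MeasurableSet V := .iUnion fun n ↦ .iUnion fun i ↦ .inter
    ((measurableSet_singleton i).preimage (by fun_prop))
    ((hU i).compl.preimage (f := fun q : (ℕ → ι × (ℕ → Bool)) × X ↦ ((q.1 n).2, q.2))
      (by fun_prop))
  refine .of_standardBorel hV ?_
  rintro _ ⟨B, hB, rfl⟩
  choose i hi using hB
  choose p hp using fun n ↦ hsection (i n) _ (hi n)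
  refine ⟨fun n ↦ (i n, p n), ?_⟩
  ext x
  have hmem (n) : (p n, x) ∉ U (i n) ↔ x ∈ B n := by
    rw [← not_iff_comm.1 (Set.ext_iff.1 (hp n) x).symm]
    rfl
  simp [V, hmem]

theorem countable_Iio_of_lt_omega_one {ξ : Ordinal.{0}} (hξ : ξ < Ordinal.omega 1) :
    Countable (Iio ξ) := by
  rw [Cardinal.lt_omega_iff_card_lt, ← Cardinal.succ_aleph0, Order.lt_succ_iff] at hξ
  rwa [← Cardinal.mk_le_aleph0_iff, Cardinal.mk_Iio_ordinal, Cardinal.lift_le_aleph0]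

theorem isBorelParametrized_sigmaZero [TopologicalSpace X] [SecondCountableTopology X]
    [OpensMeasurableSpace X] {ξ : Ordinal.{0}} (hξ : ξ < Ordinal.omega 1) :
    IsBorelParametrized {A : Set X | SigmaZero ξ A} := by
  induction ξ using WellFoundedLT.induction with
  | ind ξ ih =>
  have := countable_Iio_of_lt_omega_one hξ
  by_cases h1 : ξ = 1
  · obtain ⟨U, hU, hsection⟩ := isBorelParametrized_isOpen (X := X)
    refine ⟨U, hU, fun A hA ↦ hsection A ?_⟩
    cases hA with
    | isOpen hA => exact hA
    | iUnion hlt => exact absurd h1 hlt.ne'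
  · obtain ⟨U, hU, hsection⟩ :=
      IsBorelParametrized.iUnion_compl fun η : Iio ξ ↦ ih η η.2 (η.2.trans hξ)
    refine ⟨U, hU, fun A hA ↦ hsection A ?_⟩
    cases hA with
    | isOpen => exact absurd rfl h1
    | iUnion _ B η _ hlt hB => exact ⟨B, fun n ↦ ⟨⟨η n, hlt n⟩, hB n⟩, rfl⟩

theorem IsBorelParametrized.exists_measurableSet_compl_notMem {𝒜 : Set (Set (ℕ → Bool))}
    (h𝒜 : IsBorelParametrized 𝒜) : ∃ D : Set (ℕ → Bool), MeasurableSet D ∧ Dᶜ ∉ 𝒜 := by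
  obtain ⟨U, hU, hsection⟩ := h𝒜
  refine ⟨{x | (x, x) ∈ U}, hU.preimage (measurable_id.prodMk measurable_id), fun hD ↦ ?_⟩
  obtain ⟨p, hp⟩ := hsection _ hD
  exact iff_not_self (Set.ext_iff.1 hp p)

theorem exists_measurableSet_not_piZero {ξ : Ordinal.{0}} (hξ : ξ < Ordinal.omega 1) :
    ∃ D : Set (ℕ → Bool), MeasurableSet D ∧ ¬ PiZero ξ D :=
  (isBorelParametrized_sigmaZero hξ).exists_measurableSet_compl_notMem

end Parametrization

/-! ### Comeager sets -/

section Comeager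

variable {X Y : Type*}

theorem exists_residual_continuousOn [TopologicalSpace X] [MeasurableSpace X] [BorelSpace X]
    [TopologicalSpace Y] [SecondCountableTopology Y] [MeasurableSpace Y] [OpensMeasurableSpace Y]
    {f : X → Y} (hf : Measurable f) : ∃ G ∈ residual X, ContinuousOn f G := by
  have hopen (V) (hV : V ∈ countableBasis Y) : ∃ O : Set X, IsOpen O ∧ f ⁻¹' V =ᵇ O :=
    (hf (isOpen_of_mem_countableBasis hV).measurableSet).residualEq_isOpen
  choose! O hO hVO using hopen
  refine ⟨⋂ V ∈ countableBasis Y, {x | x ∈ f ⁻¹' V ↔ x ∈ O V}, ?_, ?_⟩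
  · rw [countable_bInter_mem (countable_countableBasis Y)]
    exact fun V hV ↦ (hVO V hV).mono fun x ↦ iff_of_eq
  · refine (isBasis_countableBasis Y).continuousOn_iff.2 fun V hV ↦ ⟨O V, hO V hV, ?_⟩
    ext x
    exact and_congr_left fun hx ↦ mem_iInter₂.1 hx V hV

theorem exists_residual_continuousOn_id_of_le {σ : TopologicalSpace X} [tX : TopologicalSpace X]
    [PolishSpace X] (hσ : σ ≤ tX) (hσp : @PolishSpace X σ) :
    ∃ G ∈ residual X, @ContinuousOn X X tX σ id G := by
  let _ : MeasurableSpace X := borel X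
  have : BorelSpace X := ⟨rfl⟩
  have hσX : @OpensMeasurableSpace X σ _ := @OpensMeasurableSpace.mk X σ _
    (borel_eq_borel_of_le hσp ‹_› hσ).le
  exact @exists_residual_continuousOn X X tX _ _ σ
    (@PolishSpace.toSecondCountableTopology X σ hσp) _ hσX _ measurable_id

theorem exists_forall_add_mem_of_mem_residual {Γ ι : Type*} [AddGroup Γ] [TopologicalSpace Γ]
    [ContinuousAdd Γ] [BaireSpace Γ] [Countable ι] {G : Set Γ} (hG : G ∈ residual Γ)
    (f : ι → Γ) : ∃ y, ∀ i, y + f i ∈ G := by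
  have hy : ∀ᶠ y in residual Γ, ∀ i, y + f i ∈ G := eventually_countable_forall.2 fun i ↦
    tendsto_residual_of_isOpenMap (Homeomorph.addRight (f i)).continuous
      (Homeomorph.addRight (f i)).isOpenMap hG
  exact (dense_of_mem_residual hy).nonempty

end Comeager

/-! ### Branch indicators -/

section BranchIndicator

variable {Q : Type*}

theorem mem_res_iff {s : ℕ → Q} {n : ℕ} {q : Q} : q ∈ PiNat.res s n ↔ ∃ i < n, s i = q := by
  induction n with
  | zero => simp
  | succ n ih =>
    rw [PiNat.res_succ, List.mem_cons, ih, Nat.exists_lt_succ_right, or_comm, eq_comm (a := q)]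

theorem suffix_res_iff {s : ℕ → Q} {n : ℕ} {t : List Q} :
    t <:+ PiNat.res s n ↔ t.length ≤ n ∧ PiNat.res s t.length = t := by
  induction n with
  | zero => simp +contextual
  | succ n ih =>
    rw [PiNat.res_succ, List.suffix_cons_iff, ih, Nat.le_succ_iff, or_and_right, or_comm]
    refine or_congr_right ⟨?_, ?_⟩
    · rintro rfl
      simp
    · rintro ⟨hlen, ht⟩
      rw [← ht, hlen, PiNat.res_succ]

theorem isLocallyConstant_res [TopologicalSpace Q] [DiscreteTopology Q] (n : ℕ) :
    IsLocallyConstant fun s : ℕ → Q ↦ PiNat.res s n := by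
  induction n with
  | zero => exact .const _
  | succ n ih =>
    exact ((IsLocallyConstant.iff_continuous _).2 (continuous_apply n)).comp₂ ih List.cons

open Classical in
/-- The indicator, on the nodes of the tree of finite sequences, of the branch `s`. Nodes list
their entries in reverse order, as `PiNat.res` does. -/
noncomputable def branchIndicator (s : ℕ → Q) (t : List Q) : ℤ :=
  if PiNat.res s t.length = t then 1 else 0

open Classical in
/-- The indicator of the set of nodes that lie weakly below the node `l`: the finite approximation
of `branchIndicator` along branches through `l`. -/
noncomputable def suffixIndicator (l t : List Q) : ℤ :=
  if t <:+ l then 1 else 0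

theorem continuous_branchIndicator [TopologicalSpace Q] [DiscreteTopology Q] :
    Continuous (branchIndicator : (ℕ → Q) → List Q → ℤ) := by
  classical
  exact continuous_pi fun t ↦
    ((isLocallyConstant_res t.length).comp fun l ↦ if l = t then (1 : ℤ) else 0).continuous

theorem branchIndicator_eq_suffixIndicator {s : ℕ → Q} {n : ℕ} {t : List Q} (hn : s n ∉ t) :
    branchIndicator s t = suffixIndicator (PiNat.res s n) t := by
  have hlen (ht : PiNat.res s t.length = t) : t.length ≤ n := by
    by_contra! hlt
    exact hn (ht ▸ mem_res_iff.2 ⟨n, hlt, rfl⟩)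
  have hnode : PiNat.res s t.length = t ↔ t <:+ PiNat.res s n := by
    rw [suffix_res_iff, and_iff_right_of_imp hlen]
  classical exact if_congr hnode rfl rfl

theorem eq_or_eq_of_branchIndicator_add {a b c d : ℕ → Q}
    (h : branchIndicator a + branchIndicator d = branchIndicator b + branchIndicator c) :
    a = b ∨ a = c := by
  by_contra! hne
  obtain ⟨⟨i, hi⟩, ⟨j, hj⟩⟩ := hne.imp Function.ne_iff.1 Function.ne_iff.1
  have hb : PiNat.res b (max i j + 1) ≠ PiNat.res a (max i j + 1) := fun hres ↦
    hi (PiNat.res_eq_res.1 hres (by omega)).symm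
  have hc : PiNat.res c (max i j + 1) ≠ PiNat.res a (max i j + 1) := fun hres ↦
    hj (PiNat.res_eq_res.1 hres (by omega)).symm
  have hnode := congrFun h (PiNat.res a (max i j + 1))
  simp only [Pi.add_apply, branchIndicator, PiNat.res_length, hb, hc, if_true, if_false] at hnode
  split_ifs at hnode <;> omega

theorem branchIndicator_injective :
    Function.Injective (branchIndicator : (ℕ → Q) → List Q → ℤ) := fun _ b h ↦
  (eq_or_eq_of_branchIndicator_add (congrArg (· + branchIndicator b) h)).elim id id

end BranchIndicator

/-! ### Branches through a comeager set -/

section SteeredBranch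

variable {κ : Type*}

/-- The node of length `i` on `steeredBranch N z`. -/
def steeredNode (N : List (ℕ × κ) → ℕ) (z : ℕ → κ) : ℕ → List (ℕ × κ)
  | 0 => []
  | i + 1 => (N (steeredNode N z i), z i) :: steeredNode N z i

/-- The branch with second coordinates `z` whose first coordinates are dictated by the strategy
`N`, which sees the node reached so far. -/
def steeredBranch (N : List (ℕ × κ) → ℕ) (z : ℕ → κ) (i : ℕ) : ℕ × κ :=
  (N (steeredNode N z i), z i)

theorem res_steeredBranch (N : List (ℕ × κ) → ℕ) (z : ℕ → κ) (i : ℕ) :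
    PiNat.res (steeredBranch N z) i = steeredNode N z i := by
  induction i with
  | zero => rfl
  | succ i ih => rw [PiNat.res_succ, ih, steeredNode, steeredBranch]

theorem exists_nat_forall_add_branchIndicator_mem {O : Set (List (ℕ × κ) → ℤ)} (hO : IsOpen O)
    {y : List (ℕ × κ) → ℤ} {l : List (ℕ × κ)} (hy : y + suffixIndicator l ∈ O) :
    ∃ m : ℕ, ∀ (s : ℕ → ℕ × κ) (n : ℕ), PiNat.res s n = l → (s n).1 = m →
      y + branchIndicator s ∈ O := by
  classical
  obtain ⟨F, u, hu, hFO⟩ := isOpen_pi_iff.1 hO _ hy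
  obtain ⟨m, hm⟩ := Infinite.exists_notMem_finset (F.biUnion fun t ↦ (t.map Prod.fst).toFinset)
  refine ⟨m, fun s n hl hsm ↦ hFO fun t ht ↦ ?_⟩
  have hsn : s n ∉ t := fun hst ↦ hm <| Finset.mem_biUnion.2
    ⟨t, ht, List.mem_toFinset.2 (hsm ▸ List.mem_map_of_mem hst)⟩
  rw [Pi.add_apply, branchIndicator_eq_suffixIndicator hsn, hl]
  exact (hu t ht).2

variable [TopologicalSpace κ] [DiscreteTopology κ]

theorem isLocallyConstant_steeredNode (N : List (ℕ × κ) → ℕ) (i : ℕ) :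
    IsLocallyConstant fun z ↦ steeredNode N z i := by
  induction i with
  | zero => exact .const _
  | succ i ih =>
    exact ih.comp₂ ((IsLocallyConstant.iff_continuous _).2 (continuous_apply i))
      fun l k ↦ (N l, k) :: l

theorem continuous_steeredBranch (N : List (ℕ × κ) → ℕ) : Continuous (steeredBranch N) :=
  continuous_pi fun i ↦
    ((isLocallyConstant_steeredNode N i).comp N).continuous.prodMk (continuous_apply i)

theorem exists_branch_continuous_add_mem_of_mem_residual [Countable κ]
    {G : Set (List (ℕ × κ) → ℤ)} (hG : G ∈ residual (List (ℕ × κ) → ℤ)) :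
    ∃ (y : List (ℕ × κ) → ℤ) (s : (ℕ → κ) → ℕ → ℕ × κ), (∀ z, Prod.snd ∘ s z = z) ∧
      Continuous (fun z ↦ y + branchIndicator (s z)) ∧ ∀ z, y + branchIndicator (s z) ∈ G := by
  obtain ⟨G', hG'G, hδ, hdense⟩ := mem_residual.1 hG
  obtain ⟨O, hO, rfl⟩ := isGδ_iff_eq_iInter_nat.1 hδ
  obtain ⟨y, hy⟩ :=
    exists_forall_add_mem_of_mem_residual (residual_of_dense_Gδ hδ hdense) suffixIndicator
  choose N hN using fun l : List (ℕ × κ) ↦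
    exists_nat_forall_add_branchIndicator_mem (hO l.length) (mem_iInter.1 (hy l) l.length)
  refine ⟨y, steeredBranch N, fun _ ↦ rfl,
    continuous_const.add (continuous_branchIndicator.comp (continuous_steeredBranch N)),
    fun z ↦ hG'G (mem_iInter.2 fun i ↦ ?_)⟩
  have hmem := hN _ (steeredBranch N z) i (res_steeredBranch N z i) rfl
  rwa [← res_steeredBranch, PiNat.res_length] at hmem

end SteeredBranch

/-! ### Differences in a Sidon set -/

section DifferenceRelation

/-- The pairs whose difference lies in `K`. -/
def differenceRelation {Γ : Type*} [Sub Γ] (K : Set Γ) : Set (Γ × Γ) :=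
  (fun w ↦ w.1 - w.2) ⁻¹' K

/-- A Sidon set: `a + d = b + c` has only trivial solutions in `K`. By cancellation and symmetry,
`a = b` gives `d = c` and `a = c` gives `d = b`. -/
def IsSidon {Γ : Type*} [Add Γ] (K : Set Γ) : Prop :=
  ∀ a ∈ K, ∀ b ∈ K, ∀ c ∈ K, ∀ d ∈ K, a + d = b + c → a = b ∨ a = c

theorem IsSidon.subsingleton_or_subsingleton {Γ : Type*} [AddCommGroup Γ] {K E F : Set Γ}
    (hK : IsSidon K) (hEF : E ×ˢ F ⊆ differenceRelation K) : E.Subsingleton ∨ F.Subsingleton := by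
  by_contra! hne
  obtain ⟨⟨x, hx, x', hx', hxx'⟩, ⟨y, hy, y', hy', hyy'⟩⟩ := hne
  have hmem {a b : Γ} (ha : a ∈ E) (hb : b ∈ F) : a - b ∈ K := hEF (mk_mem_prod ha hb)
  have hsum : (x - y) + (x' - y') = (x - y') + (x' - y) := by abel
  rcases hK _ (hmem hx hy) _ (hmem hx hy') _ (hmem hx' hy) _ (hmem hx' hy') hsum with h | h
  · exact hyy' (sub_right_injective h)
  · exact hxx' (sub_left_injective h)

variable {κ : Type*}

/-- The indicators of the branches whose second coordinates form a sequence in `D`. -/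
def branchIndicatorsOver (D : Set (ℕ → κ)) : Set (List (ℕ × κ) → ℤ) :=
  branchIndicator '' {s | Prod.snd ∘ s ∈ D}

theorem isSidon_branchIndicatorsOver (D : Set (ℕ → κ)) : IsSidon (branchIndicatorsOver D) := by
  rintro _ ⟨a, -, rfl⟩ _ ⟨b, -, rfl⟩ _ ⟨c, -, rfl⟩ _ ⟨d, -, rfl⟩ h
  exact (eq_or_eq_of_branchIndicator_add h).imp (congrArg _) (congrArg _)

theorem branchIndicatorsOver_union (D E : Set (ℕ → κ)) :
    branchIndicatorsOver (D ∪ E) = branchIndicatorsOver D ∪ branchIndicatorsOver E :=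
  image_union ..

theorem disjoint_branchIndicatorsOver {D E : Set (ℕ → κ)} (h : Disjoint D E) :
    Disjoint (branchIndicatorsOver D) (branchIndicatorsOver E) :=
  (disjoint_image_iff branchIndicator_injective).2 (h.preimage _)

variable [TopologicalSpace κ] [DiscreteTopology κ] [Countable κ]

theorem analyticSet_differenceRelation_branchIndicatorsOver {D : Set (ℕ → κ)}
    (hD : AnalyticSet D) : AnalyticSet (differenceRelation (branchIndicatorsOver D)) := by
  have hbranches : AnalyticSet {s : ℕ → ℕ × κ | Prod.snd ∘ s ∈ D} :=
    hD.preimage (f := fun s : ℕ → ℕ × κ ↦ Prod.snd ∘ s) (by fun_prop)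
  exact (hbranches.image_of_continuous continuous_branchIndicator).preimage
    (continuous_fst.sub continuous_snd)

theorem exists_branch_continuous_add_of_le {σ : TopologicalSpace (List (ℕ × κ) → ℤ)}
    (hσ : σ ≤ Pi.topologicalSpace) (hσp : @PolishSpace _ σ) :
    ∃ (y : List (ℕ × κ) → ℤ) (s : (ℕ → κ) → ℕ → ℕ × κ), (∀ z, Prod.snd ∘ s z = z) ∧
      Continuous[_, σ] fun z ↦ y + branchIndicator (s z) := by
  obtain ⟨G, hG, hid⟩ :=
    @exists_residual_continuousOn_id_of_le _ σ Pi.topologicalSpace inferInstance hσ hσp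
  obtain ⟨y, s, hsnd, hs, hsG⟩ := exists_branch_continuous_add_mem_of_mem_residual hG
  exact ⟨y, s, hsnd,
    @ContinuousOn.comp_continuous _ _ _ _ Pi.topologicalSpace σ id _ _ hid hs hsG⟩

theorem not_separableByPotPiZero_differenceRelation {ξ : Ordinal.{0}} {D : Set (ℕ → κ)}
    (hD : ¬ PiZero ξ D) :
    ¬ SeparableByPotPiZero ξ (differenceRelation (branchIndicatorsOver D))
      (differenceRelation (branchIndicatorsOver Dᶜ)) := by
  rintro ⟨C, ⟨-, σ, τ, hσ, -, hσp, -, hC⟩, hAC, hCB⟩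
  obtain ⟨y, s, hsnd, hfst⟩ := exists_branch_continuous_add_of_le hσ hσp
  have hpair := @Continuous.prodMk _ _ _ σ τ _ _ _ hfst (@continuous_const _ _ _ τ y)
  have hmem {E : Set (ℕ → κ)} {z : ℕ → κ} (hz : z ∈ E) :
      (y + branchIndicator (s z), y) ∈ differenceRelation (branchIndicatorsOver E) :=
    ⟨s z, by rwa [mem_ofPred_eq, hsnd], (add_sub_cancel_left _ _).symm⟩
  have hpre : (fun z ↦ (y + branchIndicator (s z), y)) ⁻¹' C = D :=
    Subset.antisymm (fun z hz ↦ by_contra fun hzD ↦ Set.disjoint_left.1 hCB hz (hmem hzD))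
      fun z hz ↦ hAC (hmem hz)
  exact hD (hpre ▸ @PiZero.preimage _ _ _ (@instTopologicalSpaceProd _ _ σ τ) _ _ hpair _ hC)

end DifferenceRelation

/-! ### Reductions defined on the whole square -/

section Reductions

variable {X Y : Type*} [TopologicalSpace X] [TopologicalSpace Y]
  {S : Set ((ℕ → Bool) × (ℕ → Bool))} {A B : Set (X × Y)}

theorem ReducesOnProduct.exists_preimage_eq (hS : ReducesOnProduct S A B) (hAB : Disjoint A B) :
    ∃ (u : (ℕ → Bool) → X) (v : (ℕ → Bool) → Y), Continuous u ∧ Continuous v ∧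
      Prod.map u v ⁻¹' A = S ∧ Prod.map u v ⁻¹' B = Sᶜ := by
  obtain ⟨u, v, hu, hv, hSA, hSB⟩ := hS
  have hdisj : Disjoint (Prod.map u v ⁻¹' A) (Prod.map u v ⁻¹' B) := hAB.preimage _
  refine ⟨u, v, hu, hv, ?_, ?_⟩
  · exact (disjoint_compl_right_iff_subset.1 (hdisj.mono_right hSB)).antisymm hSA
  · exact (hdisj.mono_left hSA).subset_compl_left.antisymm hSB

theorem ReducesOnProduct.potPiZero [T2Space X] [T2Space Y] {ξ : Ordinal.{0}} (hξ : 1 ≤ ξ)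
    (hA : AnalyticSet A) (hB : AnalyticSet B) (hAB : Disjoint A B)
    (hrect : ∀ E F, E ×ˢ F ⊆ A ∪ B → E.Subsingleton ∨ F.Subsingleton)
    (hS : ReducesOnProduct S A B) : PotPiZero ξ S := by
  obtain ⟨u, v, hu, hv, rfl, hcompl⟩ := hS.exists_preimage_eq hAB
  have hmeas : MeasurableSet (Prod.map u v ⁻¹' A) :=
    (hA.preimage (hu.prodMap hv)).measurableSet_of_compl
      (hcompl ▸ hB.preimage (hu.prodMap hv))
  have hcover : range u ×ˢ range v ⊆ A ∪ B := by
    rintro ⟨_, _⟩ ⟨⟨α, rfl⟩, β, rfl⟩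
    by_contra! hnot
    rw [mem_union, not_or] at hnot
    exact hnot.2 (hcompl ▸ hnot.1 : (α, β) ∈ Prod.map u v ⁻¹' B)
  let o : ℕ → Bool := fun _ ↦ false
  rcases hrect _ _ hcover with hconst | hconst
  · have hstrip : Prod.map u v ⁻¹' A = univ ×ˢ (Prod.mk o ⁻¹' (Prod.map u v ⁻¹' A)) := by
      ext ⟨α, β⟩
      simp [hconst (mem_range_self α) (mem_range_self o)]
    exact hstrip ▸ potPiZero_prod hξ .univ (hmeas.preimage measurable_prodMk_left)
  · have hstrip : Prod.map u v ⁻¹' A = ((·, o) ⁻¹' (Prod.map u v ⁻¹' A)) ×ˢ univ := by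
      ext ⟨α, β⟩
      simp [hconst (mem_range_self β) (mem_range_self o)]
    exact hstrip ▸ potPiZero_prod hξ (hmeas.preimage measurable_prodMk_right) .univ

theorem exists_not_separable_forall_reducesOnProduct_potPiZero {ξ : Ordinal.{0}} (hξ : 1 ≤ ξ)
    (hξ' : ξ < Ordinal.omega 1) :
    ∃ A B : Set ((List (ℕ × Bool) → ℤ) × (List (ℕ × Bool) → ℤ)),
      AnalyticSet A ∧ AnalyticSet B ∧ Disjoint A B ∧ ¬ SeparableByPotPiZero ξ A B ∧
        ∀ S, ReducesOnProduct S A B → PotPiZero ξ S := by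
  obtain ⟨D, hD, hDξ⟩ := exists_measurableSet_not_piZero hξ'
  have hA := analyticSet_differenceRelation_branchIndicatorsOver hD.analyticSet
  have hB := analyticSet_differenceRelation_branchIndicatorsOver hD.compl.analyticSet
  have hAB : Disjoint (differenceRelation (branchIndicatorsOver D))
      (differenceRelation (branchIndicatorsOver Dᶜ)) :=
    (disjoint_branchIndicatorsOver disjoint_compl_right).preimage _
  refine ⟨_, _, hA, hB, hAB, not_separableByPotPiZero_differenceRelation hDξ, fun S hS ↦
    hS.potPiZero hξ hA hB hAB fun E F hEF ↦ ?_⟩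
  refine (isSidon_branchIndicatorsOver (D ∪ Dᶜ)).subsingleton_or_subsingleton ?_
  rwa [branchIndicatorsOver_union]

end Reductions

theorem theorem1p13_general (ξ : Ordinal.{0}) (hξ : ξ < Ordinal.omega 1) :
    ¬ ∃ S : Set ((ℕ → Bool) × (ℕ → Bool)),
      ∀ (X Y : Type) [TopologicalSpace X] [PolishSpace X] [TopologicalSpace Y] [PolishSpace Y]
        (A B : Set (X × Y)),
        AnalyticSet A → AnalyticSet B → Disjoint A B →
          Xor (SeparableByPotPiZero (1 + ξ) A B) (ReducesOnProduct S A B) := by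
  rintro ⟨S, hS⟩
  have hlt : 1 + ξ < Ordinal.omega 1 :=
    Ordinal.isPrincipal_add_omega 1 (Ordinal.one_lt_omega0.trans Ordinal.omega0_lt_omega_one) hξ
  obtain ⟨A, B, hA, hB, hAB, hsep, hpot⟩ :=
    exists_not_separable_forall_reducesOnProduct_potPiZero le_self_add hlt
  have hSpot : PotPiZero (1 + ξ) S := hpot S ((hS _ _ A B hA hB hAB).or.resolve_left hsep)
  have hSmeas : MeasurableSet S := BorelSpace.measurable_eq.ge _ hSpot.1
  have hSsep : SeparableByPotPiZero (1 + ξ) S Sᶜ := ⟨S, hSpot, Subset.rfl, disjoint_compl_right⟩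
  have hSred : ReducesOnProduct S S Sᶜ :=
    ⟨id, id, continuous_id, continuous_id, Subset.rfl, Subset.rfl⟩
  exact (xor_iff_or_and_not_and _ _).1
    (hS _ _ S Sᶜ hSmeas.analyticSet hSmeas.compl.analyticSet disjoint_compl_right)
    |>.2 ⟨hSsep, hSred⟩

theorem theorem1p13 (ξ : Ordinal.{0}) (hξ : ξ < Ordinal.omega 1) :
    ¬ ∃ S : Set ((ℕ → Bool) × (ℕ → Bool)),
      @MeasurableSet ((ℕ → Bool) × (ℕ → Bool)) (borel ((ℕ → Bool) × (ℕ → Bool))) S ∧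
        ∀ (X Y : Type) [TopologicalSpace X] [PolishSpace X] [TopologicalSpace Y] [PolishSpace Y]
          (A B : Set (X × Y)),
          MeasureTheory.AnalyticSet A → MeasureTheory.AnalyticSet B → Disjoint A B →
            Xor (SeparableByPotPiZero (1 + ξ) A B) (ReducesOnProduct S A B) :=
  fun ⟨S, _, hS⟩ ↦ theorem1p13_general ξ hξ ⟨S, hS⟩
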